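/- Let $P>0$ and let $W=p(y|x)$ be a memoryless channel with input alphabet $\mathbb{R}$ and an arbitrary (measurable) output alphabet $\mathcal{Y}$. All expectations below are taken under $x\sim\mathcal{N}(0,P)$, $y\sim W(\cdot|x)$, and logarithms are natural. Coding scheme. For block length $N$ and rate $R$, the codebook consists of $M=\lceil e^{NR}\rceil$ independent codewords $\underline{x}(1),\dots,\underline{x}(M)$, each $\mathcal{N}(\mathbf{0},P\mathbf{I}_N)$-distributed. Given a function $g:\mathcal{Y}\to\mathbb{R}$ and a scalar $a\in\mathbb{R}$, the decoder observing $y_1,\dots,y_N$ decides on a message $\hat m$ that minimizes $D(m)=\sum_{n=1}^N\,(g(y_n)-a\,x_n(m))^2$, with ties resolved by an arbitrary measurable rule that depends only on $(D(1),\dots,D(M))$. A rate $R$ is achievable with $(g,a)$ if the probability of decoding error, averaged over the messages and over the codebook ensemble, tends to $0$ as $N\to\infty$. We say that $I$ is the maximally achievable rate with $(g,a)$ if, for each tie-breaking rule, every $R<I$ is achievable and no $R>I$ is. GMI. For a set $A\subseteq\mathbb{R}$ of admissible scaling parameters, the generalized mutual information (GMI) of $g$ is $$\sup_{\theta<0,\;a\in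 A}\Big\{\theta\,\mathbf{E}\big[(g(y)-a x)^2\big]-\Lambda_a(\theta)\Big\},\qquad \Lambda_a(\theta)=\lim_{N\to\infty}\frac1N\log \mathbf{E}\Big[e^{\theta\sum_{n=1}^N(g(y_n)-a\tilde x_n)^2}\,\Big|\,y_1,\dots,y_N\Big],$$ where $y_1,y_2,\dots$ are i.i.d. channel outputs, $\tilde x_1,\tilde x_2,\dots$ are i.i.d. $\mathcal{N}(0,P)$ and independent of them, and the limit is a non-random constant, almost surely. Let a training data set $\mathcal{T}\in(\mathbb{R}\times\mathcal{Y})^L$ and a learning algorithm be given; the learnt quantities are held fixed. Suppose that the learnt function $g_\mathcal{T}$ is measurable with $\mathbf{E}[g_\mathcal{T}(y)^2]<\infty$. (A) Suppose that the algorithm learns a pair $(g_\mathcal{T},a_\mathcal{T})$ with $a_\mathcal{T}\neq0$ and $\mathbf{E}[(g_\mathcal{T}(y)-a_\mathcal{T}x)^2]\neq0$. Then the maximum $$I_{\mathrm{GMI},\mathcal{T},A}=\max_{\gamma\ge0}\left\{\frac12\log(1+\gamma)-\frac{\gamma}{2}-\frac{\gamma^2}{1+\gamma}\,\frac{\mathbf{E}[g_\mathcal{T}(y)^2]}{2a_\mathcal{T}^2P}+\gamma\,\frac{\mathbf{E}[x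 g_\mathcal{T}(y)]}{a_\mathcal{T}P}\right\}$$ exists, it is the GMI of $g_\mathcal{T}$ for $A=\{a_\mathcal{T}\}$, and it is the maximally achievable rate with $(g_\mathcal{T},a_\mathcal{T})$. (B) Suppose that the algorithm learns $g_\mathcal{T}$ only, with $\mathbf{E}[g_\mathcal{T}(y)^2]\neq0$, and let $$\Delta_{\mathcal{T},B}=\frac{(\mathbf{E}[x g_\mathcal{T}(y)])^2}{P\,\mathbf{E}[g_\mathcal{T}(y)^2]},$$ where $\Delta_{\mathcal{T},B}\ne1$. Then $$I_{\mathrm{GMI},\mathcal{T},B}=\frac12\log\frac{1}{1-\Delta_{\mathcal{T},B}}$$ is the GMI of $g_\mathcal{T}$ for $A=\mathbb{R}$ (that is, with the scaling parameter optimized). It is also the GMI for $A=\{a\}$ with $a=\mathbf{E}[x g_\mathcal{T}(y)]/P$, and the maximally achievable rate with $(g_\mathcal{T},a)$ for this $a$. -/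

import Mathlib

open MeasureTheory ProbabilityTheory Filter Topology
open scoped NNReal ENNReal

noncomputable section

namespace GMI

variable {𝒴 : Type*} [MeasurableSpace 𝒴]

/-- The joint law of channel input and output, `x ∼ 𝒩(0, P)` and `y ∼ W(· | x)`. -/
def jointLaw (P : ℝ≥0) (W : Kernel ℝ 𝒴) : Measure (ℝ × 𝒴) :=
  (gaussianReal 0 P) ⊗ₘ W

/-- The law of the channel output when the input is `𝒩(0, P)`. -/
def outputLaw (P : ℝ≥0) (W : Kernel ℝ 𝒴) : Measure 𝒴 :=
  (jointLaw P W).map Prod.snd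

/-- `E[x g(y)]` under `x ∼ 𝒩(0, P)`. -/
def corr (P : ℝ≥0) (W : Kernel ℝ 𝒴) (g : 𝒴 → ℝ) : ℝ :=
  ∫ z, z.1 * g z.2 ∂(jointLaw P W)

/-- `E[g(y)²]` under `x ∼ 𝒩(0, P)`. -/
def outPower (P : ℝ≥0) (W : Kernel ℝ 𝒴) (g : 𝒴 → ℝ) : ℝ :=
  ∫ z, g z.2 ^ 2 ∂(jointLaw P W)

/-- `E[(g(y) - a x)²]` under `x ∼ 𝒩(0, P)`. -/
def distortion (P : ℝ≥0) (W : Kernel ℝ 𝒴) (g : 𝒴 → ℝ) (a : ℝ) : ℝ :=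
  ∫ z, (g z.2 - a * z.1) ^ 2 ∂(jointLaw P W)

/-! ### The coding scheme -/

/-- The number of messages `M = ⌈e^{NR}⌉`. -/
def numMessages (N : ℕ) (R : ℝ) : ℕ := ⌈Real.exp (N * R)⌉₊

instance (N : ℕ) (R : ℝ) : NeZero (numMessages N R) :=
  ⟨(Nat.ceil_pos.mpr (Real.exp_pos _)).ne'⟩

/-- The law of the i.i.d. Gaussian codebook: `M` independent codewords, each
`𝒩(0, P I_N)`-distributed. -/
def codebookLaw (P : ℝ≥0) (N M : ℕ) : Measure (Fin M → Fin N → ℝ) :=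
  Measure.pi fun _ => Measure.pi fun _ => gaussianReal 0 P

/-- The law of the output block of the memoryless channel `W` for the input block `x`. -/
def channelLaw (W : Kernel ℝ 𝒴) {N : ℕ} (x : Fin N → ℝ) : Measure (Fin N → 𝒴) :=
  Measure.pi fun n => W (x n)

/-- The decoding metric `∑ₙ (g(yₙ) - a xₙ)²` of a codeword `x` for an output block `y`. -/
def metric (g : 𝒴 → ℝ) (a : ℝ) {N : ℕ} (y : Fin N → 𝒴) (x : Fin N → ℝ) : ℝ :=
  ∑ n, (g (y n) - a * x n) ^ 2

/-- `dec` picks, from the metrics of the `M` messages, a message whose metric is minimal. How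
ties are resolved is left open. -/
structure IsArgminRule (dec : ∀ (M : ℕ) [NeZero M], (Fin M → ℝ) → Fin M) : Prop where
  measurable : ∀ (M : ℕ) [NeZero M], Measurable (dec M)
  le : ∀ (M : ℕ) [NeZero M] (D : Fin M → ℝ) (m : Fin M), D (dec M D) ≤ D m

/-- The probability of decoding error, averaged over the `M` messages and over the codebook
ensemble. -/
def avgError (dec : ∀ (M : ℕ) [NeZero M], (Fin M → ℝ) → Fin M) (P : ℝ≥0) (W : Kernel ℝ 𝒴)
    (g : 𝒴 → ℝ) (a : ℝ) (N M : ℕ) [NeZero M] : ℝ≥0∞ :=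
  (M : ℝ≥0∞)⁻¹ * ∑ m : Fin M, ∫⁻ c,
    channelLaw W (c m) {y | dec M (fun m' => metric g a y (c m')) ≠ m} ∂(codebookLaw P N M)

/-- At rate `R` (nats per channel use) the average probability of decoding error vanishes as the
codeword length grows. -/
def Achievable (dec : ∀ (M : ℕ) [NeZero M], (Fin M → ℝ) → Fin M) (P : ℝ≥0) (W : Kernel ℝ 𝒴)
    (g : 𝒴 → ℝ) (a R : ℝ) : Prop :=
  Tendsto (fun N : ℕ => avgError dec P W g a N (numMessages N R)) atTop (𝓝 0)

/-- `I` is the maximally achievable rate of the i.i.d. Gaussian ensemble under nearest neighbor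
decoding with processing function `g` and scaling parameter `a`: all rates below `I` are
achievable and no rate above `I` is. -/
def IsMaxRate (P : ℝ≥0) (W : Kernel ℝ 𝒴) (g : 𝒴 → ℝ) (a I : ℝ) : Prop :=
  ∀ dec : ∀ (M : ℕ) [NeZero M], (Fin M → ℝ) → Fin M, IsArgminRule dec →
    (∀ R < I, Achievable dec P W g a R) ∧ (∀ R > I, ¬ Achievable dec P W g a R)

/-! ### The generalized mutual information -/

/-- `Λ_N(Nθ) = log E[exp(θ ∑ₙ (g(yₙ) - a xₙ)²) | y]`, for a codeword `x ∼ 𝒩(0, P I_N)` which is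
independent of the output sequence `y`. -/
def logMGF (P : ℝ≥0) (g : 𝒴 → ℝ) (a θ : ℝ) (y : ℕ → 𝒴) (N : ℕ) : ℝ :=
  Real.log (∫ x, Real.exp (θ * metric g a (fun n : Fin N => y n) x)
    ∂(Measure.pi fun _ : Fin N => gaussianReal 0 P))

/-- `I` is the generalized mutual information
`sup {θ E[(g(y) - a x)²] - Λ(θ) : θ < 0, a ∈ A}` for the processing function `g` when the scaling
parameter ranges over `A`. Here `Λ(θ) = lim Λ_N(Nθ) / N`, a limit that exists for almost every
output sequence. -/
def IsGMI (P : ℝ≥0) (W : Kernel ℝ 𝒴) (g : 𝒴 → ℝ) (A : Set ℝ) (I : ℝ) : Prop :=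
  ∃ Λ : ℝ → ℝ → ℝ,
    (∀ a ∈ A, ∀ θ < 0, ∀ᵐ y ∂(Measure.infinitePi fun _ : ℕ => outputLaw P W),
      Tendsto (fun N : ℕ => logMGF P g a θ y N / N) atTop (𝓝 (Λ a θ))) ∧
    IsLUB {v | ∃ a ∈ A, ∃ θ < 0, v = θ * distortion P W g a - Λ a θ} I

/-- The objective that is maximized over `γ ≥ 0` when the scaling parameter `a` is fixed. -/
def objective (P : ℝ≥0) (W : Kernel ℝ 𝒴) (g : 𝒴 → ℝ) (a γ : ℝ) : ℝ :=
  1 / 2 * Real.log (1 + γ) - γ / 2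
    - γ ^ 2 / (1 + γ) * (outPower P W g / (2 * a ^ 2 * P))
    + γ * (corr P W g / (a * P))

/-- `Δ = (E[x g(y)])² / (P E[g(y)²])`. -/
def Delta (P : ℝ≥0) (W : Kernel ℝ 𝒴) (g : 𝒴 → ℝ) : ℝ :=
  corr P W g ^ 2 / (P * outPower P W g)

end GMI

end

/-!
Given the transmitted codeword and the channel output, an independent codeword has a metric that is
a sum of squares of independent Gaussian variables, so that its normalized cumulant generating
function converges, along almost every output sequence, to an explicit `Λ_a`; the normalized metric
of the transmitted codeword converges to the distortion `d = E[(g(y) - a x)²]`. The union bound and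
Chernoff's inequality make every rate below `θ d - Λ_a(θ)` achievable. Conversely, if `θ < 0` and
`Λ_a'(θ) < d`, then as in Cramér's theorem a competing codeword has a smaller metric than the
transmitted one with probability at least about `exp (-N (θ Λ_a'(θ) - Λ_a(θ)))`, so that at rates
above this exponent some competitor wins with probability tending to `1`. At the maximizer of the
concave function `θ d - Λ_a(θ)` over `θ ≤ 0` the two exponents agree, by complementary slackness.

The substitution `γ = -2 a² P θ` turns `θ d - Λ_a(θ)` into the objective of scenario (A). In
scenario (B), `log t ≤ t - 1` at `t = (1 - 2 a² P θ) (1 - Δ)` bounds it by `log (1 / (1 - Δ)) / 2`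
for all `a` and `θ`, with equality at `a = E[x g(y)] / P` and `θ = -1 / (2 E[g(y)²] (1 - Δ))`. For
`a = 0` every codeword has the same metric, and the error probability is exactly `1 - 1 / M`.
-/

noncomputable section

namespace GMI

/-! ### Random coding over an arbitrary channel -/

section RandomCoding

variable {X Y : Type*} [MeasurableSpace X] [MeasurableSpace Y]

theorem measurable_kernel_apply_removeNth (κ : Kernel X Y) [IsSFiniteKernel κ] {n : ℕ}
    (m : Fin (n + 1)) {S : Set ((X × Y) × (Fin n → X))} (hS : MeasurableSet S) :
    Measurable fun c : Fin (n + 1) → X => κ (c m) {y | ((c m, y), m.removeNth c) ∈ S} := by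
  have hpair : Measurable fun q : (Fin (n + 1) → X) × Y => ((q.1 m, q.2), m.removeNth q.1) := by
    unfold Fin.removeNth
    fun_prop
  exact Kernel.measurable_kernel_prodMk_left
    (κ := κ.comap (fun c : Fin (n + 1) → X => c m) (measurable_pi_apply m)) (hpair hS)

theorem lintegral_pi_kernel_apply_removeNth (μ : Measure X) [SigmaFinite μ] (κ : Kernel X Y)
    [IsSFiniteKernel κ] {n : ℕ} (m : Fin (n + 1)) {S : Set ((X × Y) × (Fin n → X))}
    (hS : MeasurableSet S) :
    ∫⁻ c, κ (c m) {y | ((c m, y), m.removeNth c) ∈ S} ∂(Measure.pi fun _ => μ) =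
      ∫⁻ z, Measure.pi (fun _ => μ) (Prod.mk z ⁻¹' S) ∂(μ ⊗ₘ κ) := by
  have hinner : Measurable fun p : X × (Fin n → X) => κ p.1 {y | ((p.1, y), p.2) ∈ S} := by
    have hpair : Measurable fun q : (X × (Fin n → X)) × Y => ((q.1.1, q.2), q.1.2) := by fun_prop
    exact Kernel.measurable_kernel_prodMk_left (κ := κ.comap Prod.fst measurable_fst) (hpair hS)
  have hslice (x : X) : MeasurableSet {q : (Fin n → X) × Y | ((x, q.2), q.1) ∈ S} :=
    (show Measurable fun q : (Fin n → X) × Y => ((x, q.2), q.1) by fun_prop) hS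
  calc
    _ = ∫⁻ p, κ p.1 {y | ((p.1, y), p.2) ∈ S} ∂(μ.prod (Measure.pi fun _ => μ)) :=
      (measurePreserving_piFinSuccAbove (fun _ => μ) m).lintegral_comp hinner
    _ = ∫⁻ x, ∫⁻ c, κ x {y | ((x, y), c) ∈ S} ∂(Measure.pi fun _ => μ) ∂μ :=
      lintegral_prod _ hinner.aemeasurable
    _ = ∫⁻ x, ∫⁻ y, Measure.pi (fun _ => μ) {c | ((x, y), c) ∈ S} ∂(κ x) ∂μ :=
      lintegral_congr fun x =>
        (Measure.prod_apply (hslice x)).symm.trans (Measure.prod_apply_symm (hslice x))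
    _ = _ := (Measure.lintegral_compProd (measurable_measure_prodMk_left hS)).symm

/-- The error probability of a decoder, averaged over `M` messages and over the ensemble of
codebooks with independent codewords of law `μ`: the codeword of the message is sent over the
channel `κ`, and the decoder `δ` chooses a message on the basis of the metrics `d y` of all
codewords. -/
def ensembleError (μ : Measure X) (κ : Kernel X Y) (d : Y → X → ℝ) {M : ℕ}
    (δ : (Fin M → ℝ) → Fin M) : ℝ≥0∞ :=
  (M : ℝ≥0∞)⁻¹ * ∑ m, ∫⁻ c, κ (c m) {y | δ (fun m' => d y (c m')) ≠ m} ∂(Measure.pi fun _ => μ)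

theorem inv_mul_sum_const {M : ℕ} [NeZero M] (b : ℝ≥0∞) :
    (M : ℝ≥0∞)⁻¹ * ∑ _m : Fin M, b = b := by
  rw [Finset.sum_const, Finset.card_univ, Fintype.card_fin, nsmul_eq_mul, ← mul_assoc,
    ENNReal.inv_mul_cancel (NeZero.ne _) (ENNReal.natCast_ne_top M), one_mul]

theorem pi_exists_mem_le {ι Ω : Type*} [Fintype ι] [MeasurableSpace Ω] (μ : Measure Ω)
    [IsProbabilityMeasure μ] (s : Set Ω) :
    Measure.pi (fun _ : ι => μ) {c | ∃ i, c i ∈ s} ≤ Fintype.card ι * μ s := by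
  have hle (i : ι) : Measure.pi (fun _ : ι => μ) {c | c i ∈ s} ≤ μ s :=
    (measurePreserving_eval (fun _ => μ) i).measure_preimage_le s
  rw [Set.ofPred_exists]
  calc Measure.pi (fun _ : ι => μ) (⋃ i, {c | c i ∈ s})
      ≤ ∑ i, Measure.pi (fun _ : ι => μ) {c | c i ∈ s} := measure_iUnion_fintype_le _ _
    _ ≤ ∑ _i : ι, μ s := Finset.sum_le_sum fun i _ => hle i
    _ = Fintype.card ι * μ s := by rw [Finset.sum_const, Finset.card_univ, nsmul_eq_mul]

variable (μ : Measure X) [IsProbabilityMeasure μ] (κ : Kernel X Y) {d : Y → X → ℝ}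

theorem ensembleError_le [IsSFiniteKernel κ] (hd : Measurable (Function.uncurry d)) {M : ℕ}
    [NeZero M] {δ : (Fin M → ℝ) → Fin M} (hδ : ∀ (D : Fin M → ℝ) m, D (δ D) ≤ D m) :
    ensembleError μ κ d δ ≤
      ∫⁻ z, min 1 ((M - 1 : ℕ) * μ {x | d z.2 x ≤ d z.2 z.1}) ∂(μ ⊗ₘ κ) := by
  obtain ⟨n, rfl⟩ := Nat.exists_eq_add_one_of_ne_zero (NeZero.ne M)
  rw [ensembleError, ← inv_mul_sum_const (M := n + 1) (∫⁻ z, _ ∂(μ ⊗ₘ κ))]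
  gcongr with m _
  let S : Set ((X × Y) × (Fin n → X)) := {p | ∃ i, d p.1.2 (p.2 i) ≤ d p.1.2 p.1.1}
  have hS : MeasurableSet S := by
    simp only [S, Set.ofPred_exists]
    refine .iUnion fun i => measurableSet_le
      (f := fun p : (X × Y) × (Fin n → X) => d p.1.2 (p.2 i)) (g := fun p => d p.1.2 p.1.1) ?_ ?_
    · exact hd.comp (by fun_prop : Measurable fun p : (X × Y) × (Fin n → X) => (p.1.2, p.2 i))
    · exact hd.comp (by fun_prop : Measurable fun p : (X × Y) × (Fin n → X) => (p.1.2, p.1.1))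
  calc
    _ ≤ ∫⁻ c, κ (c m) {y | ((c m, y), m.removeNth c) ∈ S} ∂(Measure.pi fun _ => μ) := by
      refine lintegral_mono fun c => measure_mono fun y hy => ?_
      obtain ⟨i, hi⟩ := Fin.exists_succAbove_eq hy
      exact ⟨i, (congrArg (fun j => d y (c j)) hi).trans_le
        (hδ (fun m' => d y (c m')) m)⟩
    _ = ∫⁻ z, Measure.pi (fun _ => μ) (Prod.mk z ⁻¹' S) ∂(μ ⊗ₘ κ) :=
      lintegral_pi_kernel_apply_removeNth μ κ m hS
    _ ≤ _ := lintegral_mono fun z => le_min prob_le_one <|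
      (pi_exists_mem_le μ {x | d z.2 x ≤ d z.2 z.1}).trans_eq (by rw [Fintype.card_fin]; rfl)

theorem one_le_ensembleError_add [IsMarkovKernel κ] (hd : Measurable (Function.uncurry d)) {M : ℕ}
    [NeZero M] {δ : (Fin M → ℝ) → Fin M} (hδ : ∀ (D : Fin M → ℝ) m, D (δ D) ≤ D m) :
    1 ≤ ensembleError μ κ d δ + ∫⁻ z, μ {x | d z.2 z.1 ≤ d z.2 x} ^ (M - 1) ∂(μ ⊗ₘ κ) := by
  obtain ⟨n, rfl⟩ := Nat.exists_eq_add_one_of_ne_zero (NeZero.ne M)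
  rw [ensembleError, ← inv_mul_sum_const (M := n + 1) (∫⁻ z, _ ∂(μ ⊗ₘ κ)), ← mul_add,
    ← Finset.sum_add_distrib, ← inv_mul_sum_const (M := n + 1) 1]
  gcongr with m _
  let S : Set ((X × Y) × (Fin n → X)) := {p | ∀ i, d p.1.2 p.1.1 ≤ d p.1.2 (p.2 i)}
  have hS : MeasurableSet S := by
    simp only [S, Set.ofPred_forall]
    refine .iInter fun i => measurableSet_le
      (f := fun p : (X × Y) × (Fin n → X) => d p.1.2 p.1.1) (g := fun p => d p.1.2 (p.2 i)) ?_ ?_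
    · exact hd.comp (by fun_prop : Measurable fun p : (X × Y) × (Fin n → X) => (p.1.2, p.1.1))
    · exact hd.comp (by fun_prop : Measurable fun p : (X × Y) × (Fin n → X) => (p.1.2, p.2 i))
  have hpow (z : X × Y) : Measure.pi (fun _ => μ) (Prod.mk z ⁻¹' S) =
      μ {x | d z.2 z.1 ≤ d z.2 x} ^ n := by
    rw [show Prod.mk z ⁻¹' S = Set.univ.pi fun _ => {x | d z.2 z.1 ≤ d z.2 x} by
      ext c; simp [S], Measure.pi_pi, Finset.prod_const, Finset.card_univ, Fintype.card_fin]
  rw [add_tsub_cancel_right, ← lintegral_congr hpow,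
    ← lintegral_pi_kernel_apply_removeNth μ κ m hS,
    ← lintegral_add_right _ (measurable_kernel_apply_removeNth κ m hS)]
  calc (1 : ℝ≥0∞) = ∫⁻ _ : Fin (n + 1) → X, 1 ∂(Measure.pi fun _ => μ) := by simp
    _ ≤ _ := lintegral_mono fun c => ?_
  rw [← measure_univ (μ := κ (c m))]
  refine (measure_mono fun y _ => ?_).trans (measure_union_le _ _)
  by_cases hy : δ (fun m' => d y (c m')) = m
  · refine Or.inr fun i => ?_
    simpa only [hy, Fin.removeNth_apply] using hδ (fun m' => d y (c m')) (m.succAbove i)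
  · exact Or.inl hy

theorem ensembleError_const_metric_add_inv [IsMarkovKernel κ] {d₀ : Y → ℝ}
    (hd₀ : Measurable d₀) {M : ℕ} [NeZero M] {δ : (Fin M → ℝ) → Fin M} (hδ : Measurable δ) :
    ensembleError μ κ (fun y _ => d₀ y) δ + (M : ℝ≥0∞)⁻¹ = 1 := by
  let v : Y → Fin M := fun y => δ fun _ => d₀ y
  have hv (m : Fin M) : MeasurableSet (v ⁻¹' {m}) :=
    (hδ.comp (measurable_pi_lambda _ fun _ => hd₀)) (measurableSet_singleton m)
  have herror (m : Fin M) : ∫⁻ c, κ (c m) {y | v y ≠ m} ∂(Measure.pi fun _ => μ) =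
      (μ ⊗ₘ κ).snd (v ⁻¹' {m})ᶜ := by
    rw [Measure.snd_compProd, Measure.bind_apply (hv m).compl κ.aemeasurable]
    exact (measurePreserving_eval (fun _ => μ) m).lintegral_comp (κ.measurable_coe (hv m).compl)
  have hcorrect : ∑ m, (μ ⊗ₘ κ).snd (v ⁻¹' {m}) = 1 := by
    rw [← measure_biUnion_finset (fun i _ j _ hij => ?_) fun m _ => hv m]
    · rw [show ⋃ m ∈ Finset.univ, v ⁻¹' {m} = Set.univ by ext; simp, measure_univ]
    · exact Disjoint.preimage v (Set.disjoint_singleton.2 hij)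
  calc
    _ = (M : ℝ≥0∞)⁻¹ * ∑ m, ((μ ⊗ₘ κ).snd (v ⁻¹' {m})ᶜ + (μ ⊗ₘ κ).snd (v ⁻¹' {m})) := by
      simp_rw [Finset.sum_add_distrib, hcorrect, mul_add, mul_one, ← herror]
      rfl
    _ = 1 := by
      simp_rw [add_comm _ ((μ ⊗ₘ κ).snd (v ⁻¹' {_})), measure_add_measure_compl (hv _),
        measure_univ, inv_mul_sum_const]

end RandomCoding

/-! ### Memoryless extensions -/

section Block

variable {X Y : Type*} [MeasurableSpace X] [MeasurableSpace Y]

theorem lintegral_pi_prod_eq_prod {ι : Type*} [Fintype ι] (μ : ι → Measure X)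
    [∀ i, IsProbabilityMeasure (μ i)] {f : ι → X → ℝ≥0∞} (hf : ∀ i, Measurable (f i)) :
    ∫⁻ x, ∏ i, f i (x i) ∂(Measure.pi μ) = ∏ i, ∫⁻ x, f i x ∂(μ i) := by
  refine (lintegral_prod_eq_prod_lintegral_of_indepFun Finset.univ (fun i (x : ι → X) => f i (x i))
    (iIndepFun_pi fun i => (hf i).aemeasurable)
    fun i => (hf i).comp (measurable_pi_apply i)).trans ?_
  exact Finset.prod_congr rfl fun i _ => (measurePreserving_eval μ i).lintegral_comp (hf i)

/-- The memoryless extension of the channel `κ` to blocks indexed by `ι`: given the input block,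
the outputs are independent, and each of them depends on its own input only. -/
def piKernel (κ : Kernel X Y) [IsMarkovKernel κ] (ι : Type*) [Fintype ι] :
    Kernel (ι → X) (ι → Y) where
  toFun x := Measure.pi fun i => κ (x i)
  measurable' := by
    refine Measurable.measure_of_isPiSystem_of_isProbabilityMeasure generateFrom_pi.symm
      isPiSystem_pi ?_
    rintro _ ⟨s, hs, rfl⟩
    simp only [Measure.pi_pi]
    exact Finset.measurable_fun_prod _ fun i _ =>
      (κ.measurable_coe (hs i (Set.mem_univ i))).comp (measurable_pi_apply i)

variable (μ : Measure X) [IsProbabilityMeasure μ] (κ : Kernel X Y) [IsMarkovKernel κ]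

instance (ι : Type*) [Fintype ι] : IsMarkovKernel (piKernel κ ι) :=
  ⟨fun x => inferInstanceAs (IsProbabilityMeasure (Measure.pi fun i => κ (x i)))⟩

theorem measurePreserving_arrowProdEquivProdArrow (ι : Type*) [Fintype ι] :
    MeasurePreserving (MeasurableEquiv.arrowProdEquivProdArrow X Y ι)
      (Measure.pi fun _ => μ ⊗ₘ κ) ((Measure.pi fun _ => μ) ⊗ₘ piKernel κ ι) := by
  refine MeasurePreserving.symm (MeasurableEquiv.arrowProdEquivProdArrow X Y ι).symm
    ⟨MeasurableEquiv.measurable _, (Measure.pi_eq fun s hs => ?_).symm⟩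
  have hbox (x : ι → X) :
      piKernel κ ι x (Prod.mk x ⁻¹'
        ((MeasurableEquiv.arrowProdEquivProdArrow X Y ι).symm ⁻¹' Set.univ.pi s)) =
      ∏ i, κ (x i) (Prod.mk (x i) ⁻¹' s i) :=
    Measure.pi_pi (fun i => κ (x i)) fun i => Prod.mk (x i) ⁻¹' s i
  rw [MeasurableEquiv.map_apply,
    Measure.compProd_apply ((MeasurableEquiv.measurable _) (MeasurableSet.univ_pi hs)),
    lintegral_congr hbox,
    lintegral_pi_prod_eq_prod _ fun i => Kernel.measurable_kernel_prodMk_left (hs i)]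
  exact Finset.prod_congr rfl fun i _ => (Measure.compProd_apply (hs i)).symm

theorem measurePreserving_infinitePi_block (N : ℕ) :
    MeasurePreserving (fun ω : ℕ → X × Y => (fun n : Fin N => (ω n).1, fun n : Fin N => (ω n).2))
      (Measure.infinitePi fun _ => μ ⊗ₘ κ) ((Measure.pi fun _ => μ) ⊗ₘ piKernel κ (Fin N)) := by
  have hfin : MeasurePreserving (fun (ω : ℕ → X × Y) (n : Fin N) => ω n)
      (Measure.infinitePi fun _ => μ ⊗ₘ κ) (Measure.pi fun _ => μ ⊗ₘ κ) :=
    ⟨by fun_prop, by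
      rw [← Measure.infinitePi_eq_pi]
      exact Measure.map_infinitePi_infinitePi_of_inj (P := fun _ : ℕ => μ ⊗ₘ κ) Fin.val_injective⟩
  exact (measurePreserving_arrowProdEquivProdArrow μ κ (Fin N)).comp hfin

theorem ae_tendsto_average {f : X → ℝ} (hf : Measurable f) (hi : Integrable f μ) :
    ∀ᵐ ω ∂(Measure.infinitePi fun _ : ℕ => μ),
      Tendsto (fun N : ℕ => (∑ n : Fin N, f (ω n)) / N) atTop (𝓝 (∫ x, f x ∂μ)) := by
  have heval (n : ℕ) : MeasurePreserving (fun ω : ℕ → X => ω n) (Measure.infinitePi fun _ => μ) μ :=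
    measurePreserving_eval_infinitePi (fun _ => μ) n
  have hident (n : ℕ) : IdentDistrib (fun ω : ℕ → X => ω n) (fun ω => ω 0)
      (Measure.infinitePi fun _ => μ) (Measure.infinitePi fun _ => μ) :=
    ⟨(heval n).aemeasurable, (heval 0).aemeasurable, (heval n).map_eq.trans (heval 0).map_eq.symm⟩
  have hlln := strong_law_ae_real (fun n (ω : ℕ → X) => f (ω n))
    ((heval 0).integrable_comp_of_integrable hi)
    (fun i j hij => (iIndepFun_infinitePi (P := fun _ => μ) fun _ => hf).indepFun hij)
    fun n => (hident n).comp hf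
  have hmean : ∫ ω, f (ω 0) ∂(Measure.infinitePi fun _ : ℕ => μ) = ∫ x, f x ∂μ := by
    rw [← integral_map (heval 0).aemeasurable hf.aestronglyMeasurable, (heval 0).map_eq]
  filter_upwards [hlln] with ω hω
  simpa only [Finset.sum_range, hmean] using hω

end Block

/-! ### Large deviations -/

theorem tendsto_exp_nhds_zero_of_tendsto_div {c : ℕ → ℝ} {l : ℝ} (hl : l < 0)
    (hc : Tendsto (fun N => c N / N) atTop (𝓝 l)) :
    Tendsto (fun N => Real.exp (c N)) atTop (𝓝 0) := by
  refine Real.tendsto_exp_comp_nhds_zero.2 ?_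
  refine (tendsto_natCast_atTop_atTop.atTop_mul_neg hl hc).congr' ?_
  filter_upwards [eventually_ne_atTop 0] with N hN
  exact mul_div_cancel₀ _ (Nat.cast_ne_zero.2 hN)

theorem tendsto_natCast_mul_div (b : ℝ) : Tendsto (fun N : ℕ => N * b / N) atTop (𝓝 b) := by
  refine tendsto_const_nhds.congr' ?_
  filter_upwards [eventually_ne_atTop 0] with N hN
  exact (mul_div_cancel_left₀ b (Nat.cast_ne_zero.2 hN)).symm

theorem exp_le_numMessages (N : ℕ) (R : ℝ) : Real.exp (N * R) ≤ numMessages N R :=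
  Nat.le_ceil _

theorem natCast_numMessages_sub_one_le (N : ℕ) (R : ℝ) :
    ((numMessages N R - 1 : ℕ) : ℝ) ≤ Real.exp (N * R) := by
  rw [Nat.cast_pred (NeZero.pos _), sub_le_iff_le_add]
  exact (Nat.ceil_lt_add_one (Real.exp_nonneg _)).le

section Tilting

variable {Ω : Type*} [MeasurableSpace Ω] {μ : Measure Ω} [IsProbabilityMeasure μ] {D : Ω → ℝ}

-- The three terms bound the contributions of `s ≤ D < t`, of `t ≤ D` and of `D < s`. When the last
-- two are at most a fraction of `mgf D μ θ`, this is a lower bound on the probability of `D < t`.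
theorem mgf_le_of_split (hD : Measurable D) {θ η : ℝ} (hθ : θ ≤ 0) (hη : 0 ≤ η)
    (hadd : Integrable (fun ω => Real.exp ((θ + η) * D ω)) μ)
    (hsub : Integrable (fun ω => Real.exp ((θ - η) * D ω)) μ) (s t : ℝ) :
    mgf D μ θ ≤ Real.exp (θ * s) * μ.real {ω | D ω < t} + Real.exp (-(η * t)) * mgf D μ (θ + η) +
      Real.exp (η * s) * mgf D μ (θ - η) := by
  have hmeas : MeasurableSet {ω | D ω < t} := measurableSet_lt hD measurable_const
  have hpoint (ω : Ω) : Real.exp (θ * D ω) ≤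
      Real.exp (θ * s) * {ω | D ω < t}.indicator 1 ω +
        Real.exp (-(η * t)) * Real.exp ((θ + η) * D ω) +
        Real.exp (η * s) * Real.exp ((θ - η) * D ω) := by
    have hind : 0 ≤ Real.exp (θ * s) * {ω | D ω < t}.indicator (1 : Ω → ℝ) ω :=
      mul_nonneg (Real.exp_nonneg _) (Set.indicator_nonneg (fun _ _ => zero_le_one) ω)
    simp only [← Real.exp_add]
    rcases lt_or_ge (D ω) s with hs | hs
    · have : Real.exp (θ * D ω) ≤ Real.exp (η * s + (θ - η) * D ω) :=
        Real.exp_le_exp.2 (by nlinarith)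
      have := Real.exp_nonneg (-(η * t) + (θ + η) * D ω)
      linarith
    rcases lt_or_ge (D ω) t with ht | ht
    · have : Real.exp (θ * D ω) ≤ Real.exp (θ * s) := Real.exp_le_exp.2 (by nlinarith)
      rw [Set.indicator_of_mem (by exact ht), Pi.one_apply, mul_one]
      have := Real.exp_nonneg (-(η * t) + (θ + η) * D ω)
      have := Real.exp_nonneg (η * s + (θ - η) * D ω)
      linarith
    · have : Real.exp (θ * D ω) ≤ Real.exp (-(η * t) + (θ + η) * D ω) :=
        Real.exp_le_exp.2 (by nlinarith)
      have := Real.exp_nonneg (η * s + (θ - η) * D ω)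
      linarith
  have hind : Integrable (fun ω => Real.exp (θ * s) * {ω | D ω < t}.indicator (1 : Ω → ℝ) ω) μ :=
    ((integrable_const (1 : ℝ)).indicator hmeas).const_mul _
  calc mgf D μ θ ≤ ∫ ω, (Real.exp (θ * s) * {ω | D ω < t}.indicator 1 ω +
        Real.exp (-(η * t)) * Real.exp ((θ + η) * D ω) +
        Real.exp (η * s) * Real.exp ((θ - η) * D ω)) ∂μ :=
      integral_mono_of_nonneg (.of_forall fun ω => Real.exp_nonneg _)
        ((hind.add (hadd.const_mul _)).add (hsub.const_mul _)) (.of_forall hpoint)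
    _ = _ := by
      rw [integral_add (by exact hind.add (hadd.const_mul _)) (hsub.const_mul _),
        integral_add hind (hadd.const_mul _)]
      simp only [integral_const_mul, integral_indicator_one hmeas, mgf]

theorem one_le_exp_mul_measureReal_add (hD : Measurable D) {θ η : ℝ} (hθ : θ ≤ 0) (hη : 0 ≤ η)
    (hadd : Integrable (fun ω => Real.exp ((θ + η) * D ω)) μ)
    (hsub : Integrable (fun ω => Real.exp ((θ - η) * D ω)) μ) (s t : ℝ) :
    1 ≤ Real.exp (θ * s - cgf D μ θ) * μ.real {ω | D ω < t} +
      Real.exp (cgf D μ (θ + η) - cgf D μ θ - η * t) +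
      Real.exp (cgf D μ (θ - η) - cgf D μ θ + η * s) := by
  have hθint : Integrable (fun ω => Real.exp (θ * D ω)) μ :=
    integrable_exp_mul_of_le_of_le hsub hadd (by linarith) (by linarith)
  have h := mgf_le_of_split hD hθ hη hadd hsub s t
  rw [← exp_cgf hθint, ← exp_cgf hadd, ← exp_cgf hsub] at h
  refine le_of_mul_le_mul_left ?_ (Real.exp_pos (cgf D μ θ))
  rw [mul_one]
  refine h.trans_eq ?_
  simp only [mul_add, ← mul_assoc, ← Real.exp_add]
  ring_nf

end Tilting

theorem exists_pos_add_lt_and_sub_lt {Λ : ℝ → ℝ} {θ m b d : ℝ} (hΛ : HasDerivAt Λ m θ)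
    (hb : b < m) (hd : m < d) (hθ : θ < 0) :
    ∃ η > 0, θ + η < 0 ∧ Λ (θ + η) < Λ θ + η * d ∧ Λ (θ - η) < Λ θ - η * b := by
  have hslope := hasDerivAt_iff_tendsto_slope_zero.1 hΛ
  have hright := (hslope.mono_left (nhdsGT_le_nhdsNE 0)).eventually (gt_mem_nhds hd)
  have hneg : Tendsto (fun η : ℝ => -η) (𝓝[>] 0) (𝓝[≠] 0) := by
    have := (tendsto_neg_nhdsGT (a := (0 : ℝ))).mono_right (nhdsLT_le_nhdsNE (-0))
    rwa [neg_zero] at this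
  have hleft := (hslope.comp hneg).eventually (lt_mem_nhds hb)
  have hsmall : ∀ᶠ η : ℝ in 𝓝[>] 0, η < -θ := nhdsWithin_le_nhds (gt_mem_nhds (by linarith))
  obtain ⟨η, (hη : 0 < η), hr, hl, hs⟩ :=
    (eventually_mem_nhdsWithin.and (hright.and (hleft.and hsmall))).exists
  refine ⟨η, hη, by linarith, ?_, ?_⟩
  · rw [smul_eq_mul, inv_mul_lt_iff₀ hη] at hr
    linarith
  · simp only [Function.comp_apply, smul_eq_mul, inv_neg, neg_mul, lt_neg] at hl
    rw [inv_mul_lt_iff₀ hη] at hl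
    rw [← sub_eq_add_neg] at hl
    linarith

section LargeDeviations

variable {Ω : ℕ → Type*} [∀ N, MeasurableSpace (Ω N)] {μ : ∀ N, Measure (Ω N)}
  [∀ N, IsProbabilityMeasure (μ N)] {D : ∀ N, Ω N → ℝ} {t : ℕ → ℝ} {d θ R : ℝ}

theorem tendsto_numMessages_mul_measure_le {l : ℝ} (hθ : θ ≤ 0)
    (hint : ∀ N, Integrable (fun ω => Real.exp (θ * D N ω)) (μ N))
    (hΛ : Tendsto (fun N : ℕ => cgf (D N) (μ N) θ / N) atTop (𝓝 l))
    (ht : Tendsto (fun N => t N / N) atTop (𝓝 d)) (hR : R < θ * d - l) :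
    Tendsto (fun N => ((numMessages N R - 1 : ℕ) : ℝ≥0∞) * μ N {ω | D N ω ≤ t N}) atTop (𝓝 0) := by
  have hexponent : Tendsto (fun N : ℕ => (N * R + (-θ * t N + cgf (D N) (μ N) θ)) / N) atTop
      (𝓝 (R + (-θ * d + l))) := by
    simpa only [add_div, mul_div_assoc] using
      (tendsto_natCast_mul_div R).add ((ht.const_mul (-θ)).add hΛ)
  have hexp := ENNReal.tendsto_ofReal
    (tendsto_exp_nhds_zero_of_tendsto_div (by linarith) hexponent)
  rw [ENNReal.ofReal_zero] at hexp
  refine tendsto_of_tendsto_of_tendsto_of_le_of_le tendsto_const_nhds hexp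
    (fun _ => zero_le) fun N => ?_
  beta_reduce
  rw [Real.exp_add, ENNReal.ofReal_mul (Real.exp_nonneg _), ← ENNReal.ofReal_natCast,
    ← ofReal_measureReal]
  gcongr
  · exact natCast_numMessages_sub_one_le N R
  · exact measure_le_le_exp_cgf (t N) hθ (hint N)

theorem eventually_exp_le_measureReal_lt {Λ : ℝ → ℝ} {m r : ℝ} (hD : ∀ N, Measurable (D N))
    (hint : ∀ s < 0, ∀ N, Integrable (fun ω => Real.exp (s * D N ω)) (μ N))
    (hΛ : ∀ s < 0, Tendsto (fun N : ℕ => cgf (D N) (μ N) s / N) atTop (𝓝 (Λ s)))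
    (hθ : θ < 0) (hderiv : HasDerivAt Λ m θ) (ht : Tendsto (fun N => t N / N) atTop (𝓝 d))
    (hm : m < d) (hr : θ * m - Λ θ < r) :
    ∀ᶠ N : ℕ in atTop, Real.exp (-(N * r)) ≤ (μ N).real {ω | D N ω < t N} := by
  obtain ⟨b, hbr, hb⟩ : ∃ b, θ * b - Λ θ < r ∧ b < m := by
    have hcont : ContinuousAt (fun b => θ * b - Λ θ) m := by fun_prop
    exact (((hcont.eventually_lt_const hr).filter_mono nhdsWithin_le_nhds).and
      self_mem_nhdsWithin).exists (f := 𝓝[<] m)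
  obtain ⟨η, hη, hθη, hadd, hsub⟩ := exists_pos_add_lt_and_sub_lt hderiv hb hm hθ
  have hθη' : θ - η < 0 := by linarith
  have hupper : Tendsto (fun N => Real.exp
      (cgf (D N) (μ N) (θ + η) - cgf (D N) (μ N) θ - η * t N)) atTop (𝓝 0) := by
    refine tendsto_exp_nhds_zero_of_tendsto_div (l := Λ (θ + η) - Λ θ - η * d) (by linarith) ?_
    simpa only [sub_div, mul_div_assoc] using ((hΛ _ hθη).sub (hΛ θ hθ)).sub (ht.const_mul η)
  have hlower : Tendsto (fun N : ℕ => Real.exp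
      (cgf (D N) (μ N) (θ - η) - cgf (D N) (μ N) θ + η * (N * b))) atTop (𝓝 0) := by
    refine tendsto_exp_nhds_zero_of_tendsto_div (l := Λ (θ - η) - Λ θ + η * b) (by linarith) ?_
    simpa only [sub_div, add_div, mul_div_assoc] using
      ((hΛ _ hθη').sub (hΛ θ hθ)).add ((tendsto_natCast_mul_div b).const_mul η)
  have hmiddle : Tendsto (fun N : ℕ => Real.exp
      (θ * (N * b) - cgf (D N) (μ N) θ - N * r)) atTop (𝓝 0) := by
    refine tendsto_exp_nhds_zero_of_tendsto_div (l := θ * b - Λ θ - r) (by linarith) ?_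
    simpa only [sub_div, mul_div_assoc] using
      (((tendsto_natCast_mul_div b).const_mul θ).sub (hΛ θ hθ)).sub (tendsto_natCast_mul_div r)
  filter_upwards [hupper.eventually_lt_const (show (0 : ℝ) < 1 / 4 by norm_num),
    hlower.eventually_lt_const (show (0 : ℝ) < 1 / 4 by norm_num),
    hmiddle.eventually_lt_const (show (0 : ℝ) < 1 / 2 by norm_num)] with N hu hl hm
  have hone := one_le_exp_mul_measureReal_add (hD N) hθ.le hη.le (hint _ hθη N) (hint _ hθη' N)
    (N * b) (t N)
  rw [Real.exp_sub _ (N * r), div_eq_mul_inv, ← Real.exp_neg] at hm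
  exact le_of_mul_le_mul_left (by linarith) (Real.exp_pos (θ * (N * b) - cgf (D N) (μ N) θ))

theorem tendsto_measure_le_pow_numMessages {r : ℝ} (hD : ∀ N, Measurable (D N)) (hr : r < R)
    (hlt : ∀ᶠ N : ℕ in atTop, Real.exp (-(N * r)) ≤ (μ N).real {ω | D N ω < t N}) :
    Tendsto (fun N => μ N {ω | t N ≤ D N ω} ^ (numMessages N R - 1)) atTop (𝓝 0) := by
  have hdouble : Tendsto (fun N : ℕ => 1 - Real.exp (N * (R - r))) atTop atBot :=
    tendsto_atBot_add_const_left _ _ <| tendsto_neg_atTop_atBot.comp <|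
      Real.tendsto_exp_atTop.comp <| tendsto_natCast_atTop_atTop.atTop_mul_const (sub_pos.2 hr)
  have hexp := ENNReal.tendsto_ofReal (Real.tendsto_exp_atBot.comp hdouble)
  rw [ENNReal.ofReal_zero] at hexp
  refine tendsto_of_tendsto_of_tendsto_of_le_of_le' tendsto_const_nhds hexp
    (.of_forall fun _ => zero_le) ?_
  filter_upwards [hlt] with N hN
  have hcompl : (μ N).real {ω | t N ≤ D N ω} = 1 - (μ N).real {ω | D N ω < t N} := by
    rw [← probReal_compl_eq_one_sub (measurableSet_lt (hD N) measurable_const)]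
    simp only [Set.compl_ofPred, not_lt]
  set p := (μ N).real {ω | D N ω < t N}
  have hp : Real.exp (N * (R - r)) ≤ p * numMessages N R := by
    calc Real.exp (N * (R - r)) = Real.exp (-(N * r)) * Real.exp (N * R) := by
          rw [← Real.exp_add]; ring_nf
      _ ≤ p * numMessages N R := by gcongr; exact exp_le_numMessages N R
  rw [← ofReal_measureReal, hcompl, ← ENNReal.ofReal_pow (sub_nonneg.2 measureReal_le_one)]
  refine ENNReal.ofReal_le_ofReal ?_
  calc (1 - p) ^ (numMessages N R - 1)
      ≤ Real.exp (-p) ^ (numMessages N R - 1) := by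
        gcongr
        · exact sub_nonneg.2 measureReal_le_one
        · exact Real.one_sub_le_exp_neg p
    _ = Real.exp (p - p * numMessages N R) := by
        rw [← Real.exp_nat_mul, Nat.cast_pred (NeZero.pos _)]
        ring_nf
    _ ≤ Real.exp (1 - Real.exp (N * (R - r))) :=
        Real.exp_le_exp.2 (sub_le_sub measureReal_le_one hp)

end LargeDeviations

/-! ### The nearest neighbor metric of a Gaussian codeword -/

/-- The cumulant generating function, for `2 * θ * v < 1`, of the square of a Gaussian variable
with variance `v` and squared mean `V`. It is affine in `V`, so that averaging over several squared
means amounts to evaluating it at their average. -/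
def sqCumulant (v V θ : ℝ) : ℝ :=
  -(1 / 2) * Real.log (1 - 2 * θ * v) + θ * V / (1 - 2 * θ * v)

/-- The derivative of `sqCumulant v V` at `θ`: the mean of the squared Gaussian variable under its
exponential tilt by `θ`. -/
def tiltedSqMean (v V θ : ℝ) : ℝ :=
  v / (1 - 2 * θ * v) + V / (1 - 2 * θ * v) ^ 2

section Gaussian

theorem gaussianPDFReal_mul_exp_sq (m : ℝ) {v : ℝ≥0} (hv : v ≠ 0) {θ : ℝ} (hθ : 2 * θ * v < 1)
    (x : ℝ) :
    gaussianPDFReal m v x * Real.exp (θ * x ^ 2) = Real.exp (sqCumulant v (m ^ 2) θ) *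
      gaussianPDFReal (m / (1 - 2 * θ * v)) (v / (1 - 2 * θ * v).toNNReal) x := by
  have hv₀ : (v : ℝ) ≠ 0 := NNReal.coe_ne_zero.2 hv
  rw [sqCumulant]
  set u := 1 - 2 * θ * v with hu
  have hu₀ : 0 < u := by linarith
  have hexp : Real.exp (-(x - m) ^ 2 / (2 * v)) * Real.exp (θ * x ^ 2) =
      Real.exp (θ * m ^ 2 / u) * Real.exp (-(x - m / u) ^ 2 / (2 * (v / u))) := by
    rw [← Real.exp_add, ← Real.exp_add]
    congr 1
    field_simp
    rw [hu]
    ring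
  have hsqrt : Real.exp (-(1 / 2) * Real.log u) = (√u)⁻¹ := by
    rw [Real.sqrt_eq_rpow, ← Real.rpow_neg hu₀.le, Real.rpow_def_of_pos hu₀, mul_comm]
  rw [Real.exp_add, hsqrt, gaussianPDFReal, gaussianPDFReal, NNReal.coe_div,
    Real.coe_toNNReal _ hu₀.le, mul_assoc, hexp, ← mul_div_assoc (2 * Real.pi) (v : ℝ),
    Real.sqrt_div (by positivity), inv_div]
  field_simp

theorem mgf_sq_gaussianReal (m : ℝ) (v : ℝ≥0) {θ : ℝ} (hθ : 2 * θ * v < 1) :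
    mgf (fun x => x ^ 2) (gaussianReal m v) θ = Real.exp (sqCumulant v (m ^ 2) θ) := by
  obtain rfl | hv := eq_or_ne v 0
  · simp [mgf, sqCumulant]
  have hu : 0 < 1 - 2 * θ * v := by linarith
  simp only [mgf, integral_gaussianReal_eq_integral_smul hv, smul_eq_mul,
    gaussianPDFReal_mul_exp_sq m hv hθ]
  rw [integral_const_mul, integral_gaussianPDFReal_eq_one _
    (div_pos hv.bot_lt (Real.toNNReal_pos.2 hu)).ne', mul_one]

theorem gaussianReal_zero_map_const_sub_const_mul (P : ℝ≥0) (a b : ℝ) :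
    (gaussianReal 0 P).map (fun x => b - a * x) =
      gaussianReal b (.mk (a ^ 2) (sq_nonneg a) * P) := by
  have h := gaussianReal_map_const_sub (μ := a * 0) (v := .mk (a ^ 2) (sq_nonneg a) * P) b
  rw [← gaussianReal_map_const_mul a, Measure.map_map (by fun_prop) (by fun_prop)] at h
  simpa only [mul_zero, sub_zero, Function.comp_def] using h

theorem mgf_sq_const_sub_const_mul (P : ℝ≥0) {a b θ : ℝ} (hθ : 2 * θ * (a ^ 2 * P) < 1) :
    mgf (fun x => (b - a * x) ^ 2) (gaussianReal 0 P) θ =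
      Real.exp (sqCumulant (a ^ 2 * P) (b ^ 2) θ) := by
  have h := mgf_sq_gaussianReal b (.mk (a ^ 2) (sq_nonneg a) * P) hθ
  rwa [← gaussianReal_zero_map_const_sub_const_mul,
    mgf_map (by fun_prop) (by fun_prop)] at h

end Gaussian

section Metric

variable {𝒴 : Type*} (P : ℝ≥0) (g : 𝒴 → ℝ) (a : ℝ)

theorem metric_nonneg {N : ℕ} (y : Fin N → 𝒴) (x : Fin N → ℝ) : 0 ≤ metric g a y x :=
  Finset.sum_nonneg fun _ _ => sq_nonneg _

theorem measurable_metric_right {N : ℕ} (y : Fin N → 𝒴) : Measurable (metric g a y) := by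
  unfold metric
  fun_prop

theorem measurable_uncurry_metric [MeasurableSpace 𝒴] {g : 𝒴 → ℝ} (hg : Measurable g) (N : ℕ) :
    Measurable (Function.uncurry (metric (N := N) g a)) := by
  unfold Function.uncurry metric
  fun_prop

theorem integrable_exp_metric {θ : ℝ} (hθ : θ ≤ 0) {N : ℕ} (y : Fin N → 𝒴) :
    Integrable (fun x => Real.exp (θ * metric g a y x))
      (Measure.pi fun _ : Fin N => gaussianReal 0 P) := by
  refine Integrable.of_bound (C := 1)
    ((measurable_metric_right g a y).const_mul θ).exp.aestronglyMeasurable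
    (.of_forall fun x => ?_)
  rw [Real.norm_eq_abs, Real.abs_exp, Real.exp_le_one_iff]
  exact mul_nonpos_of_nonpos_of_nonneg hθ (metric_nonneg g a y x)

theorem cgf_metric {θ : ℝ} (hθ : 2 * θ * (a ^ 2 * P) < 1) {N : ℕ} (y : Fin N → 𝒴) :
    cgf (metric g a y) (Measure.pi fun _ => gaussianReal 0 P) θ =
      ∑ n, sqCumulant (a ^ 2 * P) (g (y n) ^ 2) θ := by
  have hsum : metric g a y = ∑ n, fun x : Fin N → ℝ => (g (y n) - a * x n) ^ 2 := by
    ext x; simp only [metric, Finset.sum_apply]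
  have hindep : iIndepFun (fun n (x : Fin N → ℝ) => (g (y n) - a * x n) ^ 2)
      (Measure.pi fun _ => gaussianReal 0 P) :=
    iIndepFun_pi (X := fun n x => (g (y n) - a * x) ^ 2) fun n => by fun_prop
  have hmarginal (n : Fin N) :
      mgf (fun x : Fin N → ℝ => (g (y n) - a * x n) ^ 2) (Measure.pi fun _ => gaussianReal 0 P) θ =
        Real.exp (sqCumulant (a ^ 2 * P) (g (y n) ^ 2) θ) := by
    rw [← mgf_sq_const_sub_const_mul P hθ]
    conv_rhs => rw [← (measurePreserving_eval (fun _ : Fin N => gaussianReal 0 P) n).map_eq]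
    exact (mgf_map (X := fun x => (g (y n) - a * x) ^ 2)
      (measurable_pi_apply n).aemeasurable (by fun_prop)).symm
  rw [cgf, hsum, hindep.mgf_sum (fun n => by fun_prop),
    Finset.prod_congr rfl fun n _ => hmarginal n, ← Real.exp_sum, Real.log_exp]

theorem tendsto_cgf_metric_div {θ V : ℝ} (hθ : 2 * θ * (a ^ 2 * P) < 1) {y : ℕ → 𝒴}
    (hy : Tendsto (fun N : ℕ => (∑ n : Fin N, g (y n) ^ 2) / N) atTop (𝓝 V)) :
    Tendsto (fun N : ℕ => cgf (metric g a fun n : Fin N => y n)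
      (Measure.pi fun _ => gaussianReal 0 P) θ / N) atTop (𝓝 (sqCumulant (a ^ 2 * P) V θ)) := by
  refine ((tendsto_natCast_mul_div _).add
    ((hy.const_mul θ).div_const (1 - 2 * θ * (a ^ 2 * P)))).congr fun N => ?_
  simp only [cgf_metric P g a hθ, sqCumulant, Finset.sum_add_distrib, Finset.sum_const,
    Finset.card_univ, Fintype.card_fin, nsmul_eq_mul, ← Finset.sum_div, ← Finset.mul_sum]
  ring

end Metric

section Calculus

variable {v V θ : ℝ}

theorem one_le_one_sub_two_mul (hv : 0 ≤ v) (hθ : θ ≤ 0) : 1 ≤ 1 - 2 * θ * v := by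
  nlinarith

theorem hasDerivAt_sqCumulant (hv : 0 ≤ v) (V : ℝ) (hθ : θ ≤ 0) :
    HasDerivAt (sqCumulant v V) (tiltedSqMean v V θ) θ := by
  have hu : 1 - 2 * θ * v ≠ 0 := (zero_lt_one.trans_le (one_le_one_sub_two_mul hv hθ)).ne'
  have hlin : HasDerivAt (fun θ : ℝ => 1 - 2 * θ * v) (-(2 * v)) θ :=
    ((((hasDerivAt_id θ).const_mul 2).mul_const v).const_sub 1).congr_deriv (by ring)
  refine (((hlin.log hu).const_mul (-(1 / 2))).add
    ((((hasDerivAt_id θ).mul_const V)).div hlin hu)).congr_deriv ?_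
  rw [tiltedSqMean, id_eq]
  field_simp
  ring

theorem continuousOn_tiltedSqMean (hv : 0 ≤ v) (V : ℝ) :
    ContinuousOn (tiltedSqMean v V) (Set.Iic 0) := by
  have hu : ∀ θ ∈ Set.Iic (0 : ℝ), 1 - 2 * θ * v ≠ 0 := fun θ hθ =>
    (zero_lt_one.trans_le (one_le_one_sub_two_mul hv hθ)).ne'
  exact (continuousOn_const.div (by fun_prop) hu).add
    (continuousOn_const.div (by fun_prop) fun θ hθ => pow_ne_zero 2 (hu θ hθ))

theorem strictMonoOn_tiltedSqMean (hv : 0 < v) (hV : 0 ≤ V) :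
    StrictMonoOn (tiltedSqMean v V) (Set.Iic 0) := by
  intro θ _ θ' hθ' hlt
  have hu' : 0 < 1 - 2 * θ' * v := zero_lt_one.trans_le (one_le_one_sub_two_mul hv.le hθ')
  have hu : 1 - 2 * θ' * v < 1 - 2 * θ * v := by nlinarith
  refine add_lt_add_of_lt_of_le ?_ ?_ <;> gcongr

theorem exists_tiltedSqMean_le (hv : 0 < v) (hV : 0 ≤ V) {d : ℝ} (hd : 0 < d) :
    ∃ θ ≤ 0, tiltedSqMean v V θ ≤ d := by
  refine ⟨-((v + V) / (2 * v * d)), by rw [neg_nonpos]; positivity, ?_⟩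
  have hu : 1 - 2 * -((v + V) / (2 * v * d)) * v = 1 + (v + V) / d := by field_simp; ring
  have hone : 1 ≤ 1 + (v + V) / d := le_add_of_nonneg_right (by positivity)
  rw [tiltedSqMean, hu]
  calc v / (1 + (v + V) / d) + V / (1 + (v + V) / d) ^ 2
      ≤ v / (1 + (v + V) / d) + V / (1 + (v + V) / d) := by
        gcongr
        exact le_self_pow₀ hone two_ne_zero
    _ = d * ((v + V) / (d + (v + V))) := by field_simp
    _ ≤ d := mul_le_of_le_one_right hd.le (div_le_one_of_le₀ (by linarith) (by positivity))

end Calculus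

section MetricLargeDeviations

variable {𝒴 : Type*} (P : ℝ≥0) (g : 𝒴 → ℝ) (a : ℝ)

theorem tendsto_numMessages_mul_measure_metric_le {y : ℕ → 𝒴} {t : ℕ → ℝ} {d V θ R : ℝ}
    (hy : Tendsto (fun N : ℕ => (∑ n : Fin N, g (y n) ^ 2) / N) atTop (𝓝 V))
    (ht : Tendsto (fun N => t N / N) atTop (𝓝 d)) (hθ : θ ≤ 0)
    (hR : R < θ * d - sqCumulant (a ^ 2 * P) V θ) :
    Tendsto (fun N => ((numMessages N R - 1 : ℕ) : ℝ≥0∞) *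
      (Measure.pi fun _ : Fin N => gaussianReal 0 P) {x | metric g a (fun n => y n) x ≤ t N})
      atTop (𝓝 0) :=
  tendsto_numMessages_mul_measure_le (μ := fun N => Measure.pi fun _ : Fin N => gaussianReal 0 P)
    (D := fun N => metric g a fun n : Fin N => y n) hθ
    (fun N => integrable_exp_metric P g a hθ _)
    (tendsto_cgf_metric_div P g a (by nlinarith [mul_nonneg (sq_nonneg a) P.coe_nonneg]) hy) ht hR

theorem tendsto_measure_metric_ge_pow_numMessages {y : ℕ → 𝒴} {t : ℕ → ℝ} {d V θ R : ℝ}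
    (hy : Tendsto (fun N : ℕ => (∑ n : Fin N, g (y n) ^ 2) / N) atTop (𝓝 V))
    (ht : Tendsto (fun N => t N / N) atTop (𝓝 d)) (hθ : θ < 0)
    (hlt : tiltedSqMean (a ^ 2 * P) V θ < d)
    (hR : θ * tiltedSqMean (a ^ 2 * P) V θ - sqCumulant (a ^ 2 * P) V θ < R) :
    Tendsto (fun N => (Measure.pi fun _ : Fin N => gaussianReal 0 P)
      {x | t N ≤ metric g a (fun n => y n) x} ^ (numMessages N R - 1)) atTop (𝓝 0) := by
  obtain ⟨r, hr, hrR⟩ := exists_between hR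
  have haP : 0 ≤ a ^ 2 * P := by positivity
  have hmetric (N : ℕ) := measurable_metric_right g a fun n : Fin N => y n
  have hlower := eventually_exp_le_measureReal_lt
    (μ := fun N => Measure.pi fun _ : Fin N => gaussianReal 0 P) hmetric
    (fun s hs N => integrable_exp_metric P g a hs.le _)
    (fun s hs => tendsto_cgf_metric_div P g a (by nlinarith) hy) hθ
    (hasDerivAt_sqCumulant haP V hθ.le) ht hlt hr
  exact tendsto_measure_le_pow_numMessages hmetric hrR hlower

end MetricLargeDeviations

/-! ### Maximizing a concave function over a half-line -/

section Legendre

/-- The Karush–Kuhn–Tucker conditions, at `θ₀`, for the maximization of `θ * d - L θ` over `θ ≤ 0`,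
where `L'` is the derivative of `L`. -/
structure IsOptimalTilt (L' : ℝ → ℝ) (d θ₀ : ℝ) : Prop where
  nonpos : θ₀ ≤ 0
  deriv_le : L' θ₀ ≤ d
  slack : θ₀ * (d - L' θ₀) = 0

variable {L L' : ℝ → ℝ} {d θ₀ : ℝ}

theorem exists_isOptimalTilt (hc : ContinuousOn L' (Set.Iic 0)) (hd : ∃ θ ≤ 0, L' θ ≤ d) :
    ∃ θ₀, IsOptimalTilt L' d θ₀ := by
  obtain ⟨θ, hθ, hle⟩ := hd
  rcases le_or_gt (L' 0) d with h0 | h0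
  · exact ⟨0, le_rfl, h0, zero_mul _⟩
  · obtain ⟨θ₀, hθ₀, heq⟩ := intermediate_value_Icc hθ (hc.mono Set.Icc_subset_Iic_self)
      ⟨hle, h0.le⟩
    exact ⟨θ₀, hθ₀.2, heq.le, by rw [heq, sub_self, mul_zero]⟩

theorem add_deriv_mul_le_of_monotoneOn (hL : ∀ θ ≤ 0, HasDerivAt L (L' θ) θ)
    (hL' : MonotoneOn L' (Set.Iic 0)) {θ : ℝ} (hθ₀ : θ₀ ≤ 0) (hθ : θ ≤ 0) :
    L θ₀ + L' θ₀ * (θ - θ₀) ≤ L θ := by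
  have hconv : ConvexOn ℝ (Set.Iic 0) L := by
    have hint (θ : ℝ) (hθ : θ ∈ interior (Set.Iic 0)) := hL θ (Set.mem_Iic.1 (interior_subset hθ))
    exact MonotoneOn.convexOn_of_deriv (convex_Iic 0)
      (fun θ hθ => (hL θ hθ).continuousAt.continuousWithinAt)
      (fun θ hθ => (hint θ hθ).differentiableAt.differentiableWithinAt)
      ((hL'.mono interior_subset).congr fun θ hθ => (hint θ hθ).deriv.symm)
  rcases lt_trichotomy θ θ₀ with h | rfl | h
  · have hslope := hconv.slope_le_of_hasDerivAt hθ hθ₀ h (hL θ₀ hθ₀)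
    rw [slope_def_field, div_le_iff₀ (sub_pos.2 h)] at hslope
    linarith
  · simp
  · have hslope := hconv.le_slope_of_hasDerivAt hθ₀ hθ h (hL θ₀ hθ₀)
    rw [slope_def_field, le_div_iff₀ (sub_pos.2 h)] at hslope
    linarith

theorem IsOptimalTilt.mul_sub_le (h : IsOptimalTilt L' d θ₀)
    (hL : ∀ θ ≤ 0, HasDerivAt L (L' θ) θ) (hL' : MonotoneOn L' (Set.Iic 0)) {θ : ℝ} (hθ : θ ≤ 0) :
    θ * d - L θ ≤ θ₀ * d - L θ₀ := by
  have htangent := add_deriv_mul_le_of_monotoneOn hL hL' h.nonpos hθ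
  have hsign : θ * (d - L' θ₀) ≤ 0 :=
    mul_nonpos_of_nonpos_of_nonneg hθ (sub_nonneg.2 h.deriv_le)
  linarith [h.slack]

theorem IsOptimalTilt.isLUB (h : IsOptimalTilt L' d θ₀) (hL : ∀ θ ≤ 0, HasDerivAt L (L' θ) θ)
    (hL' : MonotoneOn L' (Set.Iic 0)) :
    IsLUB ((fun θ => θ * d - L θ) '' Set.Iio 0) (θ₀ * d - L θ₀) := by
  refine isLUB_of_mem_closure ?_ ?_
  · rintro _ ⟨θ, hθ, rfl⟩
    exact h.mul_sub_le hL hL' (Set.mem_Iio.1 hθ).le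
  · have hcont : ContinuousAt (fun θ => θ * d - L θ) θ₀ :=
      (continuousAt_id.mul continuousAt_const).sub (hL θ₀ h.nonpos).continuousAt
    refine mem_closure_image (f := fun θ => θ * d - L θ) hcont ?_
    rw [closure_Iio]
    exact h.nonpos

theorem IsOptimalTilt.exists_neg_deriv_lt (h : IsOptimalTilt L' d θ₀)
    (hL : ∀ θ ≤ 0, HasDerivAt L (L' θ) θ) (hL' : StrictMonoOn L' (Set.Iic 0))
    (hc : ContinuousOn L' (Set.Iic 0)) {R : ℝ} (hR : θ₀ * d - L θ₀ < R) :
    ∃ θ < 0, L' θ < d ∧ θ * L' θ - L θ < R := by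
  have hcont : ContinuousWithinAt (fun θ => θ * L' θ - L θ) (Set.Iio θ₀) θ₀ :=
    (continuousWithinAt_id.mul ((hc θ₀ h.nonpos).mono (Set.Iio_subset_Iic h.nonpos))).sub
      (hL θ₀ h.nonpos).continuousAt.continuousWithinAt
  have hval : θ₀ * L' θ₀ - L θ₀ < R := by linarith [h.slack]
  obtain ⟨θ, hθR, hθ⟩ := ((hcont.eventually_lt_const hval).and self_mem_nhdsWithin).exists
  have hθ0 : θ < 0 := (Set.mem_Iio.1 hθ).trans_le h.nonpos
  exact ⟨θ, hθ0, (hL' hθ0.le h.nonpos hθ).trans_le h.deriv_le, hθR⟩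

end Legendre

/-! ### Rates of the Gaussian ensemble -/

variable {𝒴 : Type*} [MeasurableSpace 𝒴]

section Moments

theorem memLp_output {P : ℝ≥0} {W : Kernel ℝ 𝒴} {g : 𝒴 → ℝ} (hg : Measurable g)
    (hi : Integrable (fun z => g z.2 ^ 2) (jointLaw P W)) :
    MemLp (fun z : ℝ × 𝒴 => g z.2) 2 (jointLaw P W) :=
  (memLp_two_iff_integrable_sq (hg.comp measurable_snd).aestronglyMeasurable).2 hi

theorem outPower_nonneg (P : ℝ≥0) (W : Kernel ℝ 𝒴) (g : 𝒴 → ℝ) : 0 ≤ outPower P W g :=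
  integral_nonneg fun _ => sq_nonneg _

theorem distortion_nonneg (P : ℝ≥0) (W : Kernel ℝ 𝒴) (g : 𝒴 → ℝ) (a : ℝ) :
    0 ≤ distortion P W g a :=
  integral_nonneg fun _ => sq_nonneg _

variable (P : ℝ≥0) (W : Kernel ℝ 𝒴) [IsMarkovKernel W] {g : 𝒴 → ℝ}

instance : IsProbabilityMeasure (jointLaw P W) :=
  inferInstanceAs (IsProbabilityMeasure (gaussianReal 0 P ⊗ₘ W))

instance : IsProbabilityMeasure (outputLaw P W) :=
  Measure.isProbabilityMeasure_map measurable_snd.aemeasurable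

theorem map_fst_jointLaw : (jointLaw P W).map Prod.fst = gaussianReal 0 P :=
  Measure.fst_compProd _ _

theorem memLp_fst_jointLaw : MemLp Prod.fst 2 (jointLaw P W) := by
  have h : MemLp id 2 ((jointLaw P W).map Prod.fst) := by
    rw [map_fst_jointLaw]
    exact memLp_id_gaussianReal' 2 (by norm_num)
  exact h.comp_of_map measurable_fst.aemeasurable

theorem integral_fst_sq_jointLaw : ∫ z, z.1 ^ 2 ∂(jointLaw P W) = P := by
  have h := variance_id_gaussianReal (μ := 0) (v := P)
  rw [variance_of_integral_eq_zero aemeasurable_id integral_id_gaussianReal,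
    ← map_fst_jointLaw P W, integral_map measurable_fst.aemeasurable (by fun_prop)] at h
  exact h

variable {P W} (hg : Measurable g) (hi : Integrable (fun z => g z.2 ^ 2) (jointLaw P W)) (a : ℝ)
include hg hi

theorem integrable_sq_sub : Integrable (fun z => (g z.2 - a * z.1) ^ 2) (jointLaw P W) :=
  ((memLp_output hg hi).sub ((memLp_fst_jointLaw P W).const_mul a)).integrable_sq

theorem distortion_eq :
    distortion P W g a = outPower P W g - 2 * a * corr P W g + a ^ 2 * P := by
  have hcross : Integrable (fun z => 2 * a * (z.1 * g z.2)) (jointLaw P W) :=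
    ((memLp_fst_jointLaw P W).integrable_mul (memLp_output hg hi)).const_mul _
  have hinput : Integrable (fun z => a ^ 2 * z.1 ^ 2) (jointLaw P W) :=
    (memLp_fst_jointLaw P W).integrable_sq.const_mul _
  rw [outPower, corr, ← integral_fst_sq_jointLaw P W, ← integral_const_mul, ← integral_const_mul,
    ← integral_sub hi hcross, ← integral_add (by exact hi.sub hcross) hinput, distortion]
  congr with z
  ring

theorem ae_tendsto_distortion :
    ∀ᵐ ω ∂(Measure.infinitePi fun _ : ℕ => jointLaw P W),
      Tendsto (fun N : ℕ => metric g a (fun n : Fin N => (ω n).2) (fun n => (ω n).1) / N) atTop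
        (𝓝 (distortion P W g a)) :=
  ae_tendsto_average (jointLaw P W) (f := fun z => (g z.2 - a * z.1) ^ 2) (by fun_prop)
    (integrable_sq_sub hg hi a)

theorem ae_tendsto_outPower :
    ∀ᵐ ω ∂(Measure.infinitePi fun _ : ℕ => jointLaw P W),
      Tendsto (fun N : ℕ => (∑ n : Fin N, g (ω n).2 ^ 2) / N) atTop (𝓝 (outPower P W g)) :=
  ae_tendsto_average (jointLaw P W) (f := fun z => g z.2 ^ 2) (by fun_prop) hi

theorem ae_tendsto_logMGF {θ : ℝ} (hθ : θ ≤ 0) :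
    ∀ᵐ y ∂(Measure.infinitePi fun _ : ℕ => outputLaw P W),
      Tendsto (fun N : ℕ => logMGF P g a θ y N / N) atTop
        (𝓝 (sqCumulant (a ^ 2 * P) (outPower P W g) θ)) := by
  have hsnd : MeasurePreserving Prod.snd (jointLaw P W) (outputLaw P W) := ⟨measurable_snd, rfl⟩
  have hlln := ae_tendsto_average (outputLaw P W) (hg.pow_const 2)
    ((hsnd.integrable_comp (by fun_prop)).1 hi)
  have hmean : ∫ y, g y ^ 2 ∂(outputLaw P W) = outPower P W g :=
    integral_map measurable_snd.aemeasurable (by fun_prop)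
  filter_upwards [hlln] with y hy
  rw [hmean] at hy
  exact tendsto_cgf_metric_div P g a (by nlinarith [mul_nonneg (sq_nonneg a) P.coe_nonneg]) hy

end Moments

/-- The expression `θ E[(g(y) - a x)²] - Λ_a(θ)` whose supremum over `θ < 0` and over the admissible
`a` is the GMI. -/
def gmiObjective (P : ℝ≥0) (W : Kernel ℝ 𝒴) (g : 𝒴 → ℝ) (a θ : ℝ) : ℝ :=
  θ * distortion P W g a - sqCumulant (a ^ 2 * P) (outPower P W g) θ

section Coding

variable (P : ℝ≥0) {g : 𝒴 → ℝ} (a : ℝ)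

theorem measurable_measure_metric_le (hg : Measurable g) (N : ℕ) :
    Measurable fun z : (Fin N → ℝ) × (Fin N → 𝒴) =>
      (Measure.pi fun _ => gaussianReal 0 P) {x | metric g a z.2 x ≤ metric g a z.2 z.1} :=
  measurable_measure_prodMk_left <| measurableSet_le
    ((measurable_uncurry_metric a hg N).comp
      ((measurable_snd.comp measurable_fst).prodMk measurable_snd))
    ((measurable_uncurry_metric a hg N).comp (measurable_swap.comp measurable_fst))

theorem measurable_measure_metric_ge (hg : Measurable g) (N : ℕ) :
    Measurable fun z : (Fin N → ℝ) × (Fin N → 𝒴) =>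
      (Measure.pi fun _ => gaussianReal 0 P) {x | metric g a z.2 z.1 ≤ metric g a z.2 x} :=
  measurable_measure_prodMk_left <| measurableSet_le
    ((measurable_uncurry_metric a hg N).comp (measurable_swap.comp measurable_fst))
    ((measurable_uncurry_metric a hg N).comp
      ((measurable_snd.comp measurable_fst).prodMk measurable_snd))

variable {P a} {dec : ∀ (M : ℕ) [NeZero M], (Fin M → ℝ) → Fin M} {W : Kernel ℝ 𝒴} {θ R : ℝ}

theorem not_achievable_of_one_le_avgError_add {ε : ℕ → ℝ≥0∞} (hε : Tendsto ε atTop (𝓝 0))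
    (h : ∀ N, 1 ≤ avgError dec P W g a N (numMessages N R) + ε N) : ¬ Achievable dec P W g a R := by
  intro hach
  have hsum := Tendsto.add hach hε
  rw [add_zero] at hsum
  exact one_ne_zero (le_antisymm (ge_of_tendsto' hsum h) zero_le)

variable [IsMarkovKernel W]

theorem avgError_eq_ensembleError (N M : ℕ) [NeZero M] :
    avgError dec P W g a N M = ensembleError (Measure.pi fun _ => gaussianReal 0 P)
      (piKernel W (Fin N)) (metric g a) (dec M) :=
  rfl

theorem avgError_le (hdec : IsArgminRule dec) (hg : Measurable g) (N M : ℕ) [NeZero M] :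
    avgError dec P W g a N M ≤ ∫⁻ z, min 1 ((M - 1 : ℕ) *
      (Measure.pi fun _ => gaussianReal 0 P) {x | metric g a z.2 x ≤ metric g a z.2 z.1})
      ∂((Measure.pi fun _ => gaussianReal 0 P) ⊗ₘ piKernel W (Fin N)) := by
  rw [avgError_eq_ensembleError]
  exact ensembleError_le _ _ (measurable_uncurry_metric a hg N) (hdec.le M)

theorem one_le_avgError_add (hdec : IsArgminRule dec) (hg : Measurable g) (N M : ℕ) [NeZero M] :
    1 ≤ avgError dec P W g a N M + ∫⁻ z,
      (Measure.pi fun _ => gaussianReal 0 P) {x | metric g a z.2 z.1 ≤ metric g a z.2 x} ^ (M - 1)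
      ∂((Measure.pi fun _ => gaussianReal 0 P) ⊗ₘ piKernel W (Fin N)) := by
  rw [avgError_eq_ensembleError]
  exact one_le_ensembleError_add _ _ (measurable_uncurry_metric a hg N) (hdec.le M)

theorem tendsto_lintegral_block_of_ae_tendsto {F : ∀ N : ℕ, (Fin N → ℝ) × (Fin N → 𝒴) → ℝ≥0∞}
    (hF : ∀ N, Measurable (F N)) (hle : ∀ N z, F N z ≤ 1)
    (hlim : ∀ᵐ ω ∂(Measure.infinitePi fun _ : ℕ => jointLaw P W),
      Tendsto (fun N => F N (fun n : Fin N => (ω n).1, fun n : Fin N => (ω n).2)) atTop (𝓝 0)) :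
    Tendsto (fun N => ∫⁻ z, F N z ∂((Measure.pi fun _ => gaussianReal 0 P) ⊗ₘ piKernel W (Fin N)))
      atTop (𝓝 0) := by
  have hblock (N : ℕ) := measurePreserving_infinitePi_block (gaussianReal 0 P) W N
  have h := tendsto_lintegral_of_dominated_convergence (fun _ => 1)
    (fun N => (hF N).comp (hblock N).measurable) (fun N => .of_forall fun ω => hle N _)
    (by simp only [lintegral_one, measure_univ, ne_eq, ENNReal.one_ne_top, not_false_eq_true]) hlim
  rw [lintegral_zero] at h
  exact h.congr fun N => (hblock N).lintegral_comp (hF N)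

theorem achievable_of_lt_gmiObjective (hdec : IsArgminRule dec) (hg : Measurable g)
    (hi : Integrable (fun z => g z.2 ^ 2) (jointLaw P W)) (hθ : θ ≤ 0)
    (hR : R < gmiObjective P W g a θ) : Achievable dec P W g a R := by
  have hunion : Tendsto (fun N : ℕ => ∫⁻ z, min 1 ((numMessages N R - 1 : ℕ) *
      (Measure.pi fun _ => gaussianReal 0 P) {x | metric g a z.2 x ≤ metric g a z.2 z.1})
      ∂((Measure.pi fun _ => gaussianReal 0 P) ⊗ₘ piKernel W (Fin N))) atTop (𝓝 0) := by
    apply tendsto_lintegral_block_of_ae_tendsto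
    · exact fun N => measurable_const.min ((measurable_measure_metric_le P a hg N).const_mul _)
    · exact fun N z => min_le_left _ _
    filter_upwards [ae_tendsto_distortion hg hi a, ae_tendsto_outPower hg hi] with ω hdist hpow
    have hlim := tendsto_numMessages_mul_measure_metric_le P g a
      (y := fun n => (ω n).2) hpow hdist hθ hR
    exact tendsto_of_tendsto_of_tendsto_of_le_of_le tendsto_const_nhds hlim (fun _ => zero_le)
      fun N => min_le_right _ _
  exact tendsto_of_tendsto_of_tendsto_of_le_of_le tendsto_const_nhds hunion (fun _ => zero_le)
    fun N => avgError_le hdec hg N (numMessages N R)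

theorem not_achievable_of_tiltedSqMean_lt (hdec : IsArgminRule dec) (hg : Measurable g)
    (hi : Integrable (fun z => g z.2 ^ 2) (jointLaw P W)) (hθ : θ < 0)
    (hlt : tiltedSqMean (a ^ 2 * P) (outPower P W g) θ < distortion P W g a)
    (hR : θ * tiltedSqMean (a ^ 2 * P) (outPower P W g) θ -
      sqCumulant (a ^ 2 * P) (outPower P W g) θ < R) :
    ¬ Achievable dec P W g a R := by
  have hnone : Tendsto (fun N : ℕ => ∫⁻ z, (Measure.pi fun _ => gaussianReal 0 P)
      {x | metric g a z.2 z.1 ≤ metric g a z.2 x} ^ (numMessages N R - 1)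
      ∂((Measure.pi fun _ => gaussianReal 0 P) ⊗ₘ piKernel W (Fin N))) atTop (𝓝 0) := by
    apply tendsto_lintegral_block_of_ae_tendsto
    · exact fun N => (measurable_measure_metric_ge P a hg N).pow_const _
    · exact fun N z => pow_le_one₀ zero_le prob_le_one
    filter_upwards [ae_tendsto_distortion hg hi a, ae_tendsto_outPower hg hi] with ω hdist hpow
    exact tendsto_measure_metric_ge_pow_numMessages P g a (y := fun n => (ω n).2) hpow hdist hθ
      hlt hR
  exact not_achievable_of_one_le_avgError_add hnone
    fun N => one_le_avgError_add hdec hg N (numMessages N R)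

theorem not_achievable_zero_scaling (hdec : IsArgminRule dec) (hg : Measurable g) (hR : 0 < R) :
    ¬ Achievable dec P W g 0 R := by
  have hinv : Tendsto (fun N => (numMessages N R : ℝ≥0∞)⁻¹) atTop (𝓝 0) := by
    have hexp : Tendsto (fun N : ℕ => Real.exp (N * R)) atTop atTop :=
      Real.tendsto_exp_atTop.comp (tendsto_natCast_atTop_atTop.atTop_mul_const hR)
    exact ENNReal.tendsto_inv_nat_nhds_zero.comp (tendsto_nat_ceil_atTop.comp hexp)
  refine not_achievable_of_one_le_avgError_add hinv fun N => ?_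
  have hconst : metric (N := N) g 0 = fun y _ => ∑ n, g (y n) ^ 2 := by
    ext y x; simp only [metric, zero_mul, sub_zero]
  rw [avgError_eq_ensembleError, hconst, ensembleError_const_metric_add_inv _ _ (by fun_prop)
    (hdec.measurable _)]

end Coding

/-! ### Optimization of the rate -/

section Optimization

variable {P : ℝ≥0} {W : Kernel ℝ 𝒴} {g : 𝒴 → ℝ}

section OptimalTilt

variable {a θ₀ : ℝ} (hP : 0 < P) (ha : a ≠ 0)
include hP ha

theorem exists_isOptimalTilt_tiltedSqMean (hd : distortion P W g a ≠ 0) :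
    ∃ θ₀, IsOptimalTilt (tiltedSqMean (a ^ 2 * P) (outPower P W g)) (distortion P W g a) θ₀ := by
  have hv : 0 < a ^ 2 * P := by positivity
  exact exists_isOptimalTilt (continuousOn_tiltedSqMean hv.le _) <|
    exists_tiltedSqMean_le hv (outPower_nonneg P W g) ((distortion_nonneg P W g a).lt_of_ne' hd)

theorem IsOptimalTilt.gmiObjective_le {θ : ℝ}
    (h : IsOptimalTilt (tiltedSqMean (a ^ 2 * P) (outPower P W g)) (distortion P W g a) θ₀)
    (hθ : θ ≤ 0) : gmiObjective P W g a θ ≤ gmiObjective P W g a θ₀ := by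
  have hv : 0 < a ^ 2 * P := by positivity
  exact h.mul_sub_le (fun θ => hasDerivAt_sqCumulant hv.le _)
    (strictMonoOn_tiltedSqMean hv (outPower_nonneg P W g)).monotoneOn hθ

theorem IsOptimalTilt.isLUB_gmiObjective
    (h : IsOptimalTilt (tiltedSqMean (a ^ 2 * P) (outPower P W g)) (distortion P W g a) θ₀) :
    IsLUB (gmiObjective P W g a '' Set.Iio 0) (gmiObjective P W g a θ₀) := by
  have hv : 0 < a ^ 2 * P := by positivity
  exact h.isLUB (fun θ => hasDerivAt_sqCumulant hv.le _)
    (strictMonoOn_tiltedSqMean hv (outPower_nonneg P W g)).monotoneOn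

end OptimalTilt

variable [IsMarkovKernel W] (hg : Measurable g)
  (hi : Integrable (fun z => g z.2 ^ 2) (jointLaw P W))
include hg hi

theorem isGMI_of_isLUB {A : Set ℝ} {I : ℝ}
    (h : IsLUB {v | ∃ a ∈ A, ∃ θ < 0, v = gmiObjective P W g a θ} I) : IsGMI P W g A I :=
  ⟨fun a => sqCumulant (a ^ 2 * P) (outPower P W g),
    fun a _ _ hθ => ae_tendsto_logMGF hg hi a hθ.le, h⟩

theorem isGMI_singleton_of_isLUB {a I : ℝ} (h : IsLUB (gmiObjective P W g a '' Set.Iio 0) I) :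
    IsGMI P W g {a} I := by
  have himage : {v | ∃ a' ∈ ({a} : Set ℝ), ∃ θ < 0, v = gmiObjective P W g a' θ} =
      gmiObjective P W g a '' Set.Iio 0 := by
    ext v
    simp only [Set.mem_singleton_iff, exists_eq_left, Set.mem_ofPred_eq, Set.mem_image,
      Set.mem_Iio, eq_comm (a := v)]
  exact isGMI_of_isLUB hg hi (himage ▸ h)

section FixedScaling

variable {a θ₀ : ℝ} (hP : 0 < P) (ha : a ≠ 0)
include hP ha

theorem IsOptimalTilt.isMaxRate
    (h : IsOptimalTilt (tiltedSqMean (a ^ 2 * P) (outPower P W g)) (distortion P W g a) θ₀) :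
    IsMaxRate P W g a (gmiObjective P W g a θ₀) := by
  have hv : 0 < a ^ 2 * P := by positivity
  refine fun dec hdec => ⟨fun R hR => achievable_of_lt_gmiObjective hdec hg hi h.nonpos hR,
    fun R hR => ?_⟩
  obtain ⟨θ, hθ, hlt, hθR⟩ := h.exists_neg_deriv_lt (fun θ => hasDerivAt_sqCumulant hv.le _)
    (strictMonoOn_tiltedSqMean hv (outPower_nonneg P W g)) (continuousOn_tiltedSqMean hv.le _) hR
  exact not_achievable_of_tiltedSqMean_lt hdec hg hi hθ hlt hθR

theorem objective_eq_gmiObjective {γ : ℝ} (hγ : 1 + γ ≠ 0) :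
    objective P W g a γ = gmiObjective P W g a (-γ / (2 * (a ^ 2 * P))) := by
  have hP₀ : (P : ℝ) ≠ 0 := NNReal.coe_ne_zero.2 hP.ne'
  have hu : 1 - 2 * (-γ / (2 * (a ^ 2 * P))) * (a ^ 2 * P) = 1 + γ := by field_simp; ring
  rw [objective, gmiObjective, sqCumulant, hu, distortion_eq hg hi]
  field_simp
  ring

theorem IsOptimalTilt.isGreatest_objective
    (h : IsOptimalTilt (tiltedSqMean (a ^ 2 * P) (outPower P W g)) (distortion P W g a) θ₀) :
    IsGreatest (objective P W g a '' Set.Ici 0) (gmiObjective P W g a θ₀) := by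
  have heq {γ : ℝ} (hγ : 0 ≤ γ) := objective_eq_gmiObjective (W := W) hg hi hP ha
    (add_pos_of_pos_of_nonneg one_pos hγ).ne'
  refine ⟨⟨-θ₀ * (2 * (a ^ 2 * P)), ?_, ?_⟩, ?_⟩
  · exact mul_nonneg (neg_nonneg.2 h.nonpos) (by positivity)
  · rw [heq (mul_nonneg (neg_nonneg.2 h.nonpos) (by positivity)), ← neg_mul, neg_neg,
      mul_div_cancel_right₀ _ (by positivity)]
  · rintro _ ⟨γ, hγ : 0 ≤ γ, rfl⟩
    rw [heq hγ]
    exact h.gmiObjective_le hP ha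
      (div_nonpos_of_nonpos_of_nonneg (neg_nonpos.2 hγ) (by positivity))

end FixedScaling

section OptimizedScaling

variable (hP : 0 < P) (hV : outPower P W g ≠ 0)
include hP hV

theorem distortion_corr_div :
    distortion P W g (corr P W g / P) = outPower P W g * (1 - Delta P W g) := by
  have hP₀ : (P : ℝ) ≠ 0 := NNReal.coe_ne_zero.2 hP.ne'
  rw [distortion_eq hg hi, Delta]
  field_simp
  ring

variable (hΔ : Delta P W g ≠ 1)
include hΔ

theorem one_sub_Delta_pos : 0 < 1 - Delta P W g := by
  have hnonneg := distortion_nonneg P W g (corr P W g / P)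
  rw [distortion_corr_div hg hi hP hV] at hnonneg
  exact (nonneg_of_mul_nonneg_right hnonneg ((outPower_nonneg P W g).lt_of_ne' hV)).lt_of_ne'
    (sub_ne_zero.2 hΔ.symm)

theorem gmiObjective_le (a : ℝ) {θ : ℝ} (hθ : θ ≤ 0) :
    gmiObjective P W g a θ ≤ 1 / 2 * Real.log (1 / (1 - Delta P W g)) := by
  have hV₀ : 0 < outPower P W g := (outPower_nonneg P W g).lt_of_ne' hV
  have hΔ₀ := one_sub_Delta_pos hg hi hP hV hΔ
  rw [gmiObjective, sqCumulant]
  set u := 1 - 2 * θ * (a ^ 2 * P) with hu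
  have hu₀ : 0 < u := zero_lt_one.trans_le (one_le_one_sub_two_mul (by positivity) hθ)
  -- Replacing `log (u * (1 - Δ))` by `u * (1 - Δ) - 1` leaves the gap as a perfect square.
  have hlog := Real.log_le_sub_one_of_pos (mul_pos hu₀ hΔ₀)
  rw [Real.log_mul hu₀.ne' hΔ₀.ne'] at hlog
  have hsquare : θ * distortion P W g a - θ * outPower P W g / u +
      1 / 2 * (u * (1 - Delta P W g) - 1) =
        -((corr P W g * u + 2 * θ * a * P * outPower P W g) ^ 2 /
          (2 * P * outPower P W g * u)) := by
    rw [distortion_eq hg hi, Delta]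
    field_simp
    rw [hu]
    ring
  have hnonneg : 0 ≤ (corr P W g * u + 2 * θ * a * P * outPower P W g) ^ 2 /
      (2 * P * outPower P W g * u) := by positivity
  rw [one_div (1 - Delta P W g), Real.log_inv]
  linarith

theorem exists_gmiObjective_corr_div_eq :
    ∃ θ < 0, gmiObjective P W g (corr P W g / P) θ =
      1 / 2 * Real.log (1 / (1 - Delta P W g)) := by
  have hP₀ : (P : ℝ) ≠ 0 := NNReal.coe_ne_zero.2 hP.ne'
  have hV₀ : 0 < outPower P W g := (outPower_nonneg P W g).lt_of_ne' hV
  have hΔ₀ := one_sub_Delta_pos hg hi hP hV hΔ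
  have hscale : (corr P W g / P) ^ 2 * P = Delta P W g * outPower P W g := by
    rw [Delta]
    field_simp
  refine ⟨-(1 / (2 * outPower P W g * (1 - Delta P W g))), by rw [neg_lt_zero]; positivity, ?_⟩
  rw [gmiObjective, sqCumulant, hscale, distortion_corr_div hg hi hP hV]
  set Δ := Delta P W g
  set V := outPower P W g
  have hu : 1 - 2 * -(1 / (2 * V * (1 - Δ))) * (Δ * V) = 1 / (1 - Δ) := by
    field_simp
    ring
  rw [hu]
  field_simp
  ring

theorem isGMI_of_corr_div_mem {A : Set ℝ} (hA : corr P W g / P ∈ A) :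
    IsGMI P W g A (1 / 2 * Real.log (1 / (1 - Delta P W g))) := by
  obtain ⟨θ, hθ, heq⟩ := exists_gmiObjective_corr_div_eq hg hi hP hV hΔ
  refine isGMI_of_isLUB hg hi (IsGreatest.isLUB ⟨⟨_, hA, θ, hθ, heq.symm⟩, ?_⟩)
  rintro _ ⟨a, -, θ, hθ, rfl⟩
  exact gmiObjective_le hg hi hP hV hΔ a hθ.le

theorem isMaxRate_corr_div :
    IsMaxRate P W g (corr P W g / P) (1 / 2 * Real.log (1 / (1 - Delta P W g))) := by
  obtain hC | hC := eq_or_ne (corr P W g) 0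
  · have hzero : 1 / 2 * Real.log (1 / (1 - Delta P W g)) = 0 := by simp [Delta, hC]
    rw [hzero, hC, zero_div]
    refine fun dec hdec => ⟨fun R hR => achievable_of_lt_gmiObjective hdec hg hi le_rfl ?_,
      fun R hR => not_achievable_zero_scaling hdec hg hR⟩
    simpa [gmiObjective, sqCumulant] using hR
  · have ha : corr P W g / P ≠ 0 := div_ne_zero hC (NNReal.coe_ne_zero.2 hP.ne')
    have hd : distortion P W g (corr P W g / P) ≠ 0 := by
      rw [distortion_corr_div hg hi hP hV]
      exact mul_ne_zero hV (one_sub_Delta_pos hg hi hP hV hΔ).ne'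
    obtain ⟨θ₀, hθ₀⟩ := exists_isOptimalTilt_tiltedSqMean hP ha hd
    obtain ⟨θ, hθ, heq⟩ := exists_gmiObjective_corr_div_eq hg hi hP hV hΔ
    have hvalue : gmiObjective P W g (corr P W g / P) θ₀ =
        1 / 2 * Real.log (1 / (1 - Delta P W g)) :=
      (gmiObjective_le hg hi hP hV hΔ _ hθ₀.nonpos).antisymm
        (heq ▸ hθ₀.gmiObjective_le hP ha hθ.le)
    rw [← hvalue]
    exact hθ₀.isMaxRate hg hi hP ha

end OptimizedScaling

end Optimization

end GMI

end

/-- The generalized mutual information of a memoryless channel `W` under the i.i.d. Gaussian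
ensemble and nearest neighbor decoding, given a training data set `T` of `L` input-output pairs,
when `(g, a)` is learnt by `learnA`, and when only `g` is learnt, by `learnB`, and the optimal
scaling parameter `a = E[x g(y)] / P` is used. -/
theorem mainTheorem4 {𝒴 : Type*} [MeasurableSpace 𝒴] (P : ℝ≥0) (hP : 0 < P)
    (W : Kernel ℝ 𝒴) [IsMarkovKernel W]
    (L : ℕ) (T : Fin L → ℝ × 𝒴)
    (learnA : (Fin L → ℝ × 𝒴) → (𝒴 → ℝ) × ℝ) (learnB : (Fin L → ℝ × 𝒴) → (𝒴 → ℝ)) :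
    -- scenario (A)
    (∀ (gT : 𝒴 → ℝ) (aT : ℝ), learnA T = (gT, aT) →
      Measurable gT → Integrable (fun z => gT z.2 ^ 2) (GMI.jointLaw P W) →
      aT ≠ 0 → GMI.distortion P W gT aT ≠ 0 →
      ∃ I : ℝ, IsGreatest (GMI.objective P W gT aT '' Set.Ici 0) I ∧
        GMI.IsGMI P W gT {aT} I ∧
        GMI.IsMaxRate P W gT aT I) ∧
    -- scenario (B)
    (∀ gT : 𝒴 → ℝ, learnB T = gT →
      Measurable gT → Integrable (fun z => gT z.2 ^ 2) (GMI.jointLaw P W) →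
      GMI.outPower P W gT ≠ 0 → GMI.Delta P W gT ≠ 1 →
      GMI.IsGMI P W gT Set.univ (1 / 2 * Real.log (1 / (1 - GMI.Delta P W gT))) ∧
      GMI.IsGMI P W gT {GMI.corr P W gT / P}
        (1 / 2 * Real.log (1 / (1 - GMI.Delta P W gT))) ∧
      GMI.IsMaxRate P W gT (GMI.corr P W gT / P)
        (1 / 2 * Real.log (1 / (1 - GMI.Delta P W gT)))) := by
  refine ⟨fun g a _ hg hi ha hd => ?_, fun g _ hg hi hV hΔ => ⟨?_, ?_, ?_⟩⟩
  · obtain ⟨θ₀, hθ₀⟩ := GMI.exists_isOptimalTilt_tiltedSqMean hP ha hd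
    exact ⟨GMI.gmiObjective P W g a θ₀, hθ₀.isGreatest_objective hg hi hP ha,
      GMI.isGMI_singleton_of_isLUB hg hi (hθ₀.isLUB_gmiObjective hP ha),
      hθ₀.isMaxRate hg hi hP ha⟩
  · exact GMI.isGMI_of_corr_div_mem hg hi hP hV hΔ (Set.mem_univ _)
  · exact GMI.isGMI_of_corr_div_mem hg hi hP hV hΔ (Set.mem_singleton _)
  · exact GMI.isMaxRate_corr_div hg hi hP hV hΔ
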